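/- Let $p\ge 1$ and let $\mathbf G=[\mathbf g_1,\dots,\mathbf g_p]$ be a random complex $p\times p$ matrix with columns $\mathbf g_k\in\mathbb C^p$. Put $\check{\mathbf g}_k=[\Re \mathbf g_k^T,\Im \mathbf g_k^T]^T\in\mathbb R^{2p}$ and $\check{\mathbf g}=[\check{\mathbf g}_1^T,\dots,\check{\mathbf g}_p^T]^T\in\mathbb R^{2p^2}$, and suppose that $\check{\mathbf g}$ has a multivariate Gaussian distribution with mean $\mu=0$ and covariance matrix $\Sigma=I_{2p^2}$ (that is, the real and imaginary parts of all entries of $\mathbf G$ are i.i.d. standard real Gaussian variables). Let $\mathbf G=\mathbf Q\mathbf R$ be the QR factorization of $\mathbf G$ computed by the Gram–Schmidt algorithm: for $k=1,\dots,p$, $\mathbf R_{ik}=\mathbf q_i^H\mathbf g_k$ for $i<k$, $\mathbf w_k=\mathbf g_k-\sum_{i<k}\mathbf R_{ik}\mathbf q_i$, $\mathbf R_{kk}=\sqrt{\mathbf w_k^H\mathbf w_k}$, $\mathbf q_k=\mathbf w_k/\mathbf R_{kk}$, and $\mathbf R_{ik}=0$ for $i>k$ (where $\mathbf q_k=0$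 if $\mathbf w_k=0$). Then for every $k=1,\dots,p$ the random variable $\mathbf R_{kk}^2$ is distributed as $\chi^2_{2(p-k+1)}$, the chi-square distribution with $2(p-k+1)$ degrees of freedom, i.e. the law of the sum of the squares of $2(p-k+1)$ independent standard normal variables. -/

import Mathlib

open MeasureTheory ProbabilityTheory InnerProductSpace

noncomputable section

/-- The columns `g₁, …, g_p` of a complex `p × p` matrix, as vectors of the Hermitian space `ℂᵖ`. -/
def columns {p : ℕ} (G : Matrix (Fin p) (Fin p) ℂ) (k : Fin p) : EuclideanSpace ℂ (Fin p) :=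
  WithLp.toLp 2 (fun i => G i k)

/-- The real vector `ǧ = [ǧ₁ᵀ, …, ǧ_pᵀ]ᵀ ∈ ℝ^{2p²}` with `ǧ_k = [Re g_kᵀ, Im g_kᵀ]ᵀ ∈ ℝ^{2p}`.
The coordinate `(k, Sum.inl i)` is `Re G i k` and the coordinate `(k, Sum.inr i)` is `Im G i k`. -/
def realVec {p : ℕ} (G : Matrix (Fin p) (Fin p) ℂ) :
    EuclideanSpace ℝ (Fin p × (Fin p ⊕ Fin p)) :=
  WithLp.toLp 2 fun a => Sum.elim (fun i => (G i a.1).re) (fun i => (G i a.1).im) a.2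

/-- The factor `Q` computed by the Gram-Schmidt algorithm: its columns are `q_k = w_k / ‖w_k‖`,
where `w_k = g_k - ∑_{i < k} (q_iᴴ g_k) q_i`. -/
def qrQ {p : ℕ} (G : Matrix (Fin p) (Fin p) ℂ) : Matrix (Fin p) (Fin p) ℂ :=
  Matrix.of fun i k => gramSchmidtNormed ℂ (columns G) k i

/-- The upper triangular factor `R` computed by the Gram-Schmidt algorithm:
`R i k = q_iᴴ g_k` for `i < k`, `R k k = √(w_kᴴ w_k)`, and `R i k = 0` for `i > k`. -/
def qrR {p : ℕ} (G : Matrix (Fin p) (Fin p) ℂ) : Matrix (Fin p) (Fin p) ℂ :=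
  Matrix.of fun i k =>
    if i < k then inner ℂ (gramSchmidtNormed ℂ (columns G) i) (columns G k)
    else if i = k then ((‖gramSchmidt ℂ (columns G) k‖ : ℝ) : ℂ)
    else 0

/-- The (central) chi-square distribution with `ν` degrees of freedom: the law of
`Z₁² + ⋯ + Z_ν²` for independent standard normal variables `Z₁, …, Z_ν`. -/
def chiSquare (ν : ℕ) : Measure ℝ :=
  (Measure.pi fun _ : Fin ν => gaussianReal 0 1).map fun x => ∑ i, x i ^ 2

end

/-! Fix every column except `g_k`. Then `w_k` is the projection of `g_k` onto the orthogonal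
complement of the span of the earlier columns, a subspace of real dimension `2(p - d)`, with `d` the
complex dimension of that span. A projected standard Gaussian is standard Gaussian on the subspace,
so `‖w_k‖²` is conditionally chi-square with `2(p - d)` degrees of freedom
(`measure_norm_sq_gramSchmidt_mem_eq_lintegral`). Almost surely `d` is the number of earlier columns
(`ae_gramSchmidt_ne_zero`), so the conditional law is constant. -/

section chiSquare

variable {E : Type*} [NormedAddCommGroup E] [InnerProductSpace ℝ E] [FiniteDimensional ℝ E]
  [MeasurableSpace E] [BorelSpace E]

lemma measurable_sum_sq (n : ℕ) : Measurable fun x : Fin n → ℝ => ∑ i, x i ^ 2 := by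
  fun_prop

instance isProbabilityMeasure_chiSquare (n : ℕ) : IsProbabilityMeasure (chiSquare n) :=
  Measure.isProbabilityMeasure_map (measurable_sum_sq n).aemeasurable

/-- The squared norm of a standard Gaussian vector is chi-square distributed. -/
lemma map_norm_sq_stdGaussian :
    (stdGaussian E).map (fun x => ‖x‖ ^ 2) = chiSquare (Module.finrank ℝ E) := by
  rw [stdGaussian, chiSquare, Measure.map_map (by fun_prop) (by fun_prop)]
  congr 1
  ext x
  rw [Function.comp_apply, ← real_inner_self_eq_norm_sq,
    (stdOrthonormalBasis ℝ E).orthonormal.inner_sum]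
  simp [sq]

/-- The orthogonal projection of a standard Gaussian vector is standard Gaussian. -/
lemma map_orthogonalProjection_stdGaussian (U : Submodule ℝ E) :
    (stdGaussian E).map U.orthogonalProjectionOnto = stdGaussian U := by
  have : IsFiniteMeasure ((stdGaussian E).map U.orthogonalProjectionOnto) :=
    Measure.isFiniteMeasure_map _ _
  apply Measure.ext_of_charFun
  ext t
  rw [charFun_stdGaussian, charFun_apply, integral_map (by fun_prop) (by fun_prop)]
  simp_rw [Submodule.inner_orthogonalProjectionOnto_eq_of_mem_right]
  rw [← charFun_apply, charFun_stdGaussian, Submodule.coe_norm]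

lemma map_norm_sq_starProjection_stdGaussian (U : Submodule ℝ E) :
    (stdGaussian E).map (fun x => ‖U.starProjection x‖ ^ 2) = chiSquare (Module.finrank ℝ U) := by
  rw [← map_norm_sq_stdGaussian, ← map_orthogonalProjection_stdGaussian,
    Measure.map_map (by fun_prop) (by fun_prop)]
  rfl

lemma chiSquare_singleton_zero {n : ℕ} (hn : n ≠ 0) : chiSquare n {0} = 0 := by
  have : NeZero n := ⟨hn⟩
  rw [chiSquare, Measure.map_apply (measurable_sum_sq n) (measurableSet_singleton 0)]
  have := nullSingletonClass_gaussianReal (μ := 0) (v := 1) one_ne_zero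
  -- A vanishing sum of squares forces `x = 0`, and points are null because the Gaussian factors
  -- have no atoms.
  refine measure_mono_null (t := {0}) (fun x hx => ?_) (measure_singleton _)
  have h := (Finset.sum_eq_zero_iff_of_nonneg fun i _ => sq_nonneg (x i)).1 hx
  ext i
  simpa using h i (Finset.mem_univ i)

end chiSquare

section columns

variable {ι : Type*} [Fintype ι] {E : ι → Type*} [∀ i, NormedAddCommGroup (E i)]
  [∀ i, InnerProductSpace ℝ (E i)] [∀ i, FiniteDimensional ℝ (E i)]
  [∀ i, MeasurableSpace (E i)] [∀ i, BorelSpace (E i)]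

/-- The components of a standard Gaussian vector of an orthogonal sum are independent standard
Gaussian vectors. -/
lemma map_ofLp_stdGaussian :
    (stdGaussian (PiLp 2 E)).map WithLp.ofLp = Measure.pi fun i => stdGaussian (E i) := by
  have : IsProbabilityMeasure ((stdGaussian (PiLp 2 E)).map WithLp.ofLp) :=
    Measure.isProbabilityMeasure_map (by fun_prop)
  rw [← charFun_eq_pi_iff]
  intro t
  rw [Measure.map_map (by fun_prop) (by fun_prop)]
  have h : (WithLp.toLp 2 ∘ WithLp.ofLp : PiLp 2 E → PiLp 2 E) = id := rfl
  rw [h, Measure.map_id]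
  simp_rw [charFun_stdGaussian, ← Complex.exp_sum, ← Complex.ofReal_pow, PiLp.norm_sq_eq_of_L2]
  simp [← Finset.sum_div]

end columns

/-- The isometry `ℝ^{2p²} ≃ (ℂᵖ)ᵖ` that sends `realVec G` to the family of columns of `G`. -/
noncomputable def columnsIsometry (p : ℕ) :
    EuclideanSpace ℝ (Fin p × (Fin p ⊕ Fin p)) ≃ₗᵢ[ℝ]
      PiLp 2 fun _ : Fin p => EuclideanSpace ℂ (Fin p) where
  toFun x := WithLp.toLp 2 fun k => WithLp.toLp 2 fun i => ⟨x (k, Sum.inl i), x (k, Sum.inr i)⟩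
  invFun y := WithLp.toLp 2 fun a =>
    Sum.elim (fun i => (y a.1 i).re) (fun i => (y a.1 i).im) a.2
  map_add' x y := by ext; apply Complex.ext <;> simp
  map_smul' c x := by ext; apply Complex.ext <;> simp
  left_inv x := by ext ⟨k, i | i⟩ <;> simp
  right_inv y := by ext; simp
  norm_map' x := by
    rw [← sq_eq_sq₀ (norm_nonneg _) (norm_nonneg _), PiLp.norm_sq_eq_of_L2,
      EuclideanSpace.norm_sq_eq]
    simp_rw [EuclideanSpace.norm_sq_eq]
    simp_rw [← Complex.normSq_eq_norm_sq, Complex.normSq_apply]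
    simp [Fintype.sum_prod_type, Finset.sum_add_distrib, sq]

lemma columnsIsometry_realVec {p : ℕ} (G : Matrix (Fin p) (Fin p) ℂ) :
    WithLp.ofLp (columnsIsometry p (realVec G)) = columns G := by
  ext k i
  rfl

lemma hasLaw_columns {Ω : Type*} [MeasurableSpace Ω] {P : Measure Ω} {p : ℕ}
    {G : Ω → Matrix (Fin p) (Fin p) ℂ}
    (hG : HasLaw (fun ω => realVec (G ω)) (multivariateGaussian 0 1) P) :
    HasLaw (fun ω => columns (G ω))
      (Measure.pi fun _ : Fin p => stdGaussian (EuclideanSpace ℂ (Fin p))) P := by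
  rw [multivariateGaussian_zero_one] at hG
  have h : HasLaw (fun x => WithLp.ofLp (columnsIsometry p x))
      (Measure.pi fun _ : Fin p => stdGaussian (EuclideanSpace ℂ (Fin p)))
      (stdGaussian (EuclideanSpace ℝ (Fin p × (Fin p ⊕ Fin p)))) := by
    have hm : Measurable (columnsIsometry p) := (columnsIsometry p).continuous.measurable
    refine ⟨((WithLp.measurable_ofLp 2 _).comp hm).aemeasurable, ?_⟩
    rw [← map_ofLp_stdGaussian, ← stdGaussian_map (columnsIsometry p),
      Measure.map_map (WithLp.measurable_ofLp 2 _) hm]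
    rfl
  simpa only [columnsIsometry_realVec] using h.fun_comp hG

/-- Tonelli as resampling: an independent fresh copy of coordinate `k` leaves the product law
unchanged. This replaces conditioning on the other columns. -/
lemma MeasureTheory.lintegral_pi_eq_lintegral_update {ι : Type*} [Fintype ι] [DecidableEq ι]
    {X : ι → Type*} [∀ i, MeasurableSpace (X i)] (μ : ∀ i, Measure (X i))
    [∀ i, IsProbabilityMeasure (μ i)] {g : (∀ i, X i) → ENNReal} (hg : Measurable g) (k : ι) :
    ∫⁻ f, g f ∂Measure.pi μ = ∫⁻ f, ∫⁻ y, g (Function.update f k y) ∂μ k ∂Measure.pi μ := by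
  have hm : Measurable fun f => ∫⁻ y, g (Function.update f k y) ∂μ k := by
    rw [← lmarginal_singleton]
    exact hg.lmarginal μ
  refine lintegral_eq_of_lmarginal_eq {k} hg hm ?_
  simp [lmarginal_singleton]

section gramSchmidt

variable {ι : Type*} [LinearOrder ι] [LocallyFiniteOrderBot ι] [WellFoundedLT ι]

lemma measurable_gramSchmidt {𝕜 E : Type*} [RCLike 𝕜] [NormedAddCommGroup E]
    [InnerProductSpace 𝕜 E] [MeasurableSpace E] [BorelSpace E] [SecondCountableTopology E] (k : ι) :
    Measurable fun f : ι → E => gramSchmidt 𝕜 f k := by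
  induction k using WellFoundedLT.induction with
  | ind k ih =>
    simp_rw [gramSchmidt_def 𝕜 _ k, Submodule.starProjection_singleton]
    refine (measurable_pi_apply k).sub (Finset.measurable_sum _ fun i hi => ?_)
    have hi := ih i (Finset.mem_Iio.1 hi)
    refine Measurable.smul (Measurable.div ?_ ?_) hi
    · exact hi.inner (measurable_pi_apply k)
    · fun_prop

lemma EuclideanSpace.real_inner_eq_re_inner {n : Type*} [Fintype n] (x y : EuclideanSpace ℂ n) :
    inner ℝ x y = (inner ℂ x y).re := by
  simp [PiLp.inner_apply]

/-- The Gram-Schmidt vector is the projection, over the reals, onto the orthogonal complement of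
the span of the preceding vectors. -/
lemma gramSchmidt_update_eq_starProjection {n : Type*} [Fintype n]
    (f : ι → EuclideanSpace ℂ n) (k : ι) (y : EuclideanSpace ℂ n) :
    gramSchmidt ℂ (Function.update f k y) k =
      ((Submodule.span ℂ (f '' Set.Iio k))ᗮ.restrictScalars ℝ).starProjection y := by
  have hW : f '' Set.Iio k = Function.update f k y '' Set.Iio k :=
    Set.image_congr fun i hi => (Function.update_of_ne (ne_of_lt hi) y f).symm
  rw [hW, ← span_gramSchmidt_Iio]
  set b := gramSchmidt ℂ (Function.update f k y) with hb
  have hmem : b k ∈ (Submodule.span ℂ (b '' Set.Iio k))ᗮ := by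
    rw [Submodule.mem_orthogonal]
    intro u hu
    induction hu using Submodule.span_induction with
    | mem x hx =>
      obtain ⟨i, hi, rfl⟩ := hx
      exact gramSchmidt_orthogonal ℂ _ (ne_of_lt hi)
    | zero => simp
    | add x z _ _ hx hz => rw [inner_add_left, hx, hz, add_zero]
    | smul c x _ hx => rw [inner_smul_left, hx, mul_zero]
  have hsub : y - b k ∈ Submodule.span ℂ (b '' Set.Iio k) := by
    have := gramSchmidt_def' ℂ (Function.update f k y) k
    rw [Function.update_self, ← hb] at this
    rw [this, add_sub_cancel_left]
    refine Submodule.sum_mem _ fun i hi => ?_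
    rw [Submodule.starProjection_singleton]
    exact Submodule.smul_mem _ _ (Submodule.subset_span ⟨i, Finset.mem_Iio.1 hi, rfl⟩)
  symm
  refine Submodule.eq_starProjection_of_mem_of_inner_eq_zero hmem fun w hw => ?_
  -- The real inner product is the real part of the Hermitian one, so complex orthogonality
  -- suffices.
  rw [EuclideanSpace.real_inner_eq_re_inner, Submodule.inner_right_of_mem_orthogonal hsub hw,
    Complex.zero_re]

variable {E : Type*} [NormedAddCommGroup E] [InnerProductSpace ℂ E]

lemma finrank_restrictScalars_orthogonal [FiniteDimensional ℂ E] (W : Submodule ℂ E) :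
    Module.finrank ℝ (Wᗮ.restrictScalars ℝ) =
      2 * (Module.finrank ℂ E - Module.finrank ℂ W) := by
  have h := W.finrank_add_finrank_orthogonal
  have h' : Module.finrank ℝ (Wᗮ.restrictScalars ℝ) = 2 * Module.finrank ℂ Wᗮ :=
    finrank_real_of_complex Wᗮ
  omega

/-- If the Gram-Schmidt vectors preceding `k` do not vanish, the given vectors preceding `k` span
a space of full dimension. -/
lemma finrank_span_Iio_of_gramSchmidt_ne_zero {f : ι → E} {k : ι}
    (h : ∀ i < k, gramSchmidt ℂ f i ≠ 0) :
    Module.finrank ℂ (Submodule.span ℂ (f '' Set.Iio k)) = (Finset.Iio k).card := by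
  have hli : LinearIndependent ℂ fun i : Set.Iio k => gramSchmidt ℂ f i :=
    linearIndependent_of_ne_zero_of_inner_eq_zero (fun i => h i i.2) fun i j hij =>
      gramSchmidt_orthogonal ℂ f (Subtype.coe_ne_coe.2 hij)
  rw [← span_gramSchmidt_Iio, Set.image_eq_range, finrank_span_eq_card hli]
  simp

end gramSchmidt

section

variable {ι : Type*} [Fintype ι] [LinearOrder ι] [LocallyFiniteOrderBot ι]
  [WellFoundedLT ι] {n : Type*} [Fintype n]

/-- Conditionally on the other vectors, the squared length of a Gram-Schmidt vector is chi-square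
distributed. -/
lemma measure_norm_sq_gramSchmidt_mem_eq_lintegral (k : ι) {s : Set ℝ} (hs : MeasurableSet s) :
    (Measure.pi fun _ : ι => stdGaussian (EuclideanSpace ℂ n))
        {f | ‖gramSchmidt ℂ f k‖ ^ 2 ∈ s} =
      ∫⁻ f, chiSquare (2 * (Fintype.card n -
          Module.finrank ℂ (Submodule.span ℂ (f '' Set.Iio k)))) s
        ∂Measure.pi fun _ : ι => stdGaussian (EuclideanSpace ℂ n) := by
  have hm : MeasurableSet {f : ι → EuclideanSpace ℂ n | ‖gramSchmidt ℂ f k‖ ^ 2 ∈ s} :=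
    (measurable_gramSchmidt k).norm.pow_const 2 hs
  rw [← lintegral_indicator_one hm, lintegral_pi_eq_lintegral_update _
    (measurable_one.indicator hm) k]
  refine lintegral_congr fun f => ?_
  rw [← finrank_euclideanSpace (𝕜 := ℂ) (ι := n), ← finrank_restrictScalars_orthogonal,
    ← map_norm_sq_starProjection_stdGaussian, Measure.map_apply (by fun_prop) hs,
    ← lintegral_indicator_one (hs.preimage (by fun_prop))]
  refine lintegral_congr fun y => ?_
  change s.indicator 1 (‖gramSchmidt ℂ (Function.update f k y) k‖ ^ 2) = _
  rw [gramSchmidt_update_eq_starProjection]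
  rfl

/-- The conditional formula is applied to `{0}`. Fewer than `card n` earlier vectors, even dependent
ones, leave a positive number of degrees of freedom, hence no atom at `0`. -/
lemma ae_gramSchmidt_ne_zero (k : ι) (hk : (Finset.Iio k).card < Fintype.card n) :
    ∀ᵐ f ∂Measure.pi fun _ : ι => stdGaussian (EuclideanSpace ℂ n), gramSchmidt ℂ f k ≠ 0 := by
  have h := measure_norm_sq_gramSchmidt_mem_eq_lintegral (n := n) k (measurableSet_singleton 0)
  rw [ae_iff]
  simp only [ne_eq, not_not, Set.mem_singleton_iff, pow_eq_zero_iff two_ne_zero,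
    norm_eq_zero] at h ⊢
  rw [h]
  refine lintegral_eq_zero_of_ae_eq_zero (Filter.Eventually.of_forall fun f => ?_)
  refine chiSquare_singleton_zero ?_
  have : Module.finrank ℂ (Submodule.span ℂ (f '' Set.Iio k)) ≤ (Finset.Iio k).card := by
    have := finrank_span_finset_le_card (R := ℂ) ((Finset.Iio k).image f)
    rw [Finset.coe_image, Finset.coe_Iio] at this
    exact this.trans Finset.card_image_le
  omega

/-- The squared length of the Gram-Schmidt vector of index `k` of independent standard Gaussian
vectors is chi-square distributed. -/
lemma hasLaw_norm_sq_gramSchmidt (k : ι) (hk : (Finset.Iio k).card < Fintype.card n) :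
    HasLaw (fun f : ι → EuclideanSpace ℂ n => ‖gramSchmidt ℂ f k‖ ^ 2)
      (chiSquare (2 * (Fintype.card n - (Finset.Iio k).card)))
      (Measure.pi fun _ : ι => stdGaussian (EuclideanSpace ℂ n)) := by
  have hm : Measurable fun f : ι → EuclideanSpace ℂ n => ‖gramSchmidt ℂ f k‖ ^ 2 :=
    (measurable_gramSchmidt k).norm.pow_const 2
  refine ⟨hm.aemeasurable, Measure.ext fun s hs => ?_⟩
  have hne : ∀ᵐ f ∂Measure.pi fun _ : ι => stdGaussian (EuclideanSpace ℂ n),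
      ∀ i < k, gramSchmidt ℂ f i ≠ 0 := by
    refine ae_all_iff.2 fun i => ?_
    by_cases hi : i < k
    · have hc := Finset.card_le_card (Finset.Iio_subset_Iio hi.le)
      filter_upwards [ae_gramSchmidt_ne_zero (n := n) i (hc.trans_lt hk)] with f hf _ using hf
    · exact Filter.Eventually.of_forall fun f h => absurd h hi
  have h := measure_norm_sq_gramSchmidt_mem_eq_lintegral (n := n) k hs
  rw [Measure.map_apply hm hs]
  refine h.trans ?_
  rw [lintegral_congr_ae (g := fun _ =>
    chiSquare (2 * (Fintype.card n - (Finset.Iio k).card)) s)]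
  · simp
  · filter_upwards [hne] with f hf
    rw [finrank_span_Iio_of_gramSchmidt_ne_zero hf]

end

/-- `G` is a random complex `p × p` matrix such that `ǧ ∈ ℝ^{2p²}` is Gaussian with mean `0` and
covariance matrix `I`. The index `k : Fin p` stands for the column number `k + 1`, so that
`p - (k + 1) + 1 = p - k`. The diagonal entries of `R` are real and nonnegative, so `‖R k k‖ ^ 2`
is `(R k k)²`, as a real number. -/
theorem corollary1 {Ω : Type*} [MeasurableSpace Ω] (P : Measure Ω) [IsProbabilityMeasure P]
    (p : ℕ) (G : Ω → Matrix (Fin p) (Fin p) ℂ)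
    (hG : HasLaw (fun ω => realVec (G ω))
      (multivariateGaussian (0 : EuclideanSpace ℝ (Fin p × (Fin p ⊕ Fin p)))
        (1 : Matrix (Fin p × (Fin p ⊕ Fin p)) (Fin p × (Fin p ⊕ Fin p)) ℝ)) P)
    (k : Fin p) :
    HasLaw (fun ω => ‖qrR (G ω) k k‖ ^ 2) (chiSquare (2 * (p - (k : ℕ)))) P := by
  have h := (hasLaw_norm_sq_gramSchmidt (n := Fin p) k (by simp)).fun_comp (hasLaw_columns hG)
  simpa [qrR] using h
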